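/- Let $n,p\ge 1$ be integers, $\sigma>0$ and $\delta_0\in(0,1)$. For $v\in\mathbb{R}^n$ write $\|v\|_n=\big(\frac1n\sum_{i=1}^n v_i^2\big)^{1/2}$, and for $u\in\mathbb{R}^p$ let $(u_1^\sharp,\dots,u_p^\sharp)$ be a non-increasing rearrangement of $(|u_1|,\dots,|u_p|)$. Let $X\in\mathbb{R}^{n\times p}$ be a (deterministic) matrix with $\max_{j=1,\dots,p}\|Xe_j\|_n\le 1$, where $(e_1,\dots,e_p)$ is the canonical basis of $\mathbb{R}^p$. For $u\in\mathbb{R}^p$ set $$H(u)=(4+\sqrt2)\sum_{j=1}^p u_j^\sharp\,\sigma\sqrt{\frac{\log(2p/j)}{n}},\qquad G(u)=(4+\sqrt2)\,\sigma\sqrt{\frac{\log(1/\delta_0)}{n}}\;\|Xu\|_n .$$ If $\xi$ is a random vector in $\mathbb{R}^n$ with distribution $\mathcal N(0,\sigma^2 I_{n\times n})$, then the event $$\Big\{\tfrac1n\,\xi^{T}Xu\le\max\big(H(u),G(u)\big)\ \text{ for all } u\in\mathbb{R}^p\Big\}$$ has probability at least $1-\delta_0/2$. -/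

import Mathlib

open MeasureTheory ProbabilityTheory Matrix

noncomputable section

namespace StochasticError

/-- The empirical norm on `ℝⁿ`, `‖v‖ₙ = ((1/n) ∑ᵢ vᵢ²)^(1/2)`. -/
def empNorm {n : ℕ} (v : Fin n → ℝ) : ℝ :=
  √((1 / (n : ℝ)) * ∑ i, v i ^ 2)

/-- The non-increasing rearrangement `u♯` of `|u₁|, …, |uₚ|`: sorting `-|u|` increasingly
is sorting `|u|` non-increasingly. -/
def absSorted {p : ℕ} (u : Fin p → ℝ) (j : Fin p) : ℝ :=
  |u (Tuple.sort (fun i => -|u i|) j)|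

theorem absSorted_antitone {p : ℕ} (u : Fin p → ℝ) : Antitone (absSorted u) := by
  intro i j hij
  have h := Tuple.monotone_sort (fun i => -|u i|) hij
  simpa [absSorted] using h

theorem exists_perm_absSorted {p : ℕ} (u : Fin p → ℝ) :
    ∃ φ : Equiv.Perm (Fin p), ∀ j, absSorted u j = |u (φ j)| :=
  ⟨Tuple.sort (fun i => -|u i|), fun _ => rfl⟩

/-- `H(u) = (4 + √2) ∑ⱼ uⱼ♯ σ √(log(2p/j)/n)`; the index `j : Fin p` starts at `0`, so the
rank of `j` is `j + 1`. -/
def H (n : ℕ) {p : ℕ} (σ : ℝ) (u : Fin p → ℝ) : ℝ :=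
  (4 + √2) * ∑ j : Fin p,
    absSorted u j * (σ * √(Real.log (2 * (p : ℝ) / ((j : ℝ) + 1)) / (n : ℝ)))

/-- `G(u) = (4 + √2) σ √(log(1/δ₀)/n) ‖X u‖ₙ`. -/
def G {n p : ℕ} (X : Matrix (Fin n) (Fin p) ℝ) (σ δ₀ : ℝ) (u : Fin p → ℝ) : ℝ :=
  (4 + √2) * σ * √(Real.log (1 / δ₀) / (n : ℝ)) * empNorm (X *ᵥ u)

end StochasticError

end

/-! ### Gaussian concentration for maxima of linear functionals, by rotation. -/

section GaussianConcentration

variable {E : Type*} [NormedAddCommGroup E] [NormedSpace ℝ E] [MeasurableSpace E] [BorelSpace E]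
  [SecondCountableTopology E] [CompleteSpace E] {μ : Measure E} [IsGaussian μ]

/-! For u ≠ 0 divide (1/n) ξᵀXu by max(H(u), G(u)), and let f be the maximum of the resulting linear
functionals over finitely many u. The bound fails at one of these u exactly when f > 1. With K = 4 +
√2, the term G caps every variance by V = 1/(K² log(1/δ₀)), while H controls the typical size of f.

Typical size: each gₖ = ξᵀXeₖ/√n has variance at most σ², so exp(3gₖ²/(8σ²)) has mean at most 2.
Markov's inequality and the rearrangement inequality give f ≤ τ/K, τ = √(16/3), with probability at
least 1/2 (`measure_largeCorrelations_le`, `dotProduct_mulVec_le_H`).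

Deviation: `measure_superlevel_mul_sublevel_le` bounds P(f > s) P(f ≤ t) by exp(-2(s-t)²/(π²V)), so
no mean or median of f is needed. Taking s = 1, t = τ/K yields P(f > 1) ≤ 2δ₀^(3/2) ≤ δ₀/2 when δ₀ <
1/16. For larger δ₀ the Markov argument alone suffices, with H only. Since violation sets are open,
finitely many u are enough. -/

theorem map_strongDual_eq_gaussianReal (hμ : μ[id] = 0) (L : StrongDual ℝ E) :
    μ.map L = gaussianReal 0 (Var[L; μ]).toNNReal := by
  have h : ∫ x, L x ∂μ = 0 := by
    rw [IsGaussian.integral_dual]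
    have : ∫ x, x ∂μ = 0 := hμ
    rw [this, map_zero]
  rw [IsGaussian.map_eq_gaussianReal, h]

theorem lintegral_exp_strongDual (hμ : μ[id] = 0) (L : StrongDual ℝ E) :
    ∫⁻ x, ENNReal.ofReal (Real.exp (L x)) ∂μ = ENNReal.ofReal (Real.exp (Var[L; μ] / 2)) := by
  have hm : Measurable fun x : ℝ => ENNReal.ofReal (Real.exp x) := by fun_prop
  rw [← lintegral_map hm L.continuous.measurable, map_strongDual_eq_gaussianReal hμ]
  have hi := integrable_exp_mul_gaussianReal (μ := 0) (v := (Var[L; μ]).toNNReal) 1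
  simp only [one_mul] at hi
  rw [← ofReal_integral_eq_lintegral_ofReal hi (ae_of_all _ fun x => (Real.exp_pos x).le)]
  have h := congrFun (mgf_id_gaussianReal (μ := 0) (v := (Var[L; μ]).toNNReal)) 1
  simp only [mgf, id, one_mul] at h
  rw [h]
  simp [Real.coe_toNNReal _ (variance_nonneg _ _)]

/-- The functional L touching f from below at z.1 makes the bracket at most -sin h · L(z.2). As L
depends on z.1 only and z.2 is independent of it, Tonelli leaves a Gaussian Laplace transform. -/
theorem lintegral_exp_rotation_step_le (hμ : μ[id] = 0) {f : E → ℝ} (hfm : Measurable f) {V : ℝ}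
    (hf : ∀ x, ∃ L : StrongDual ℝ E, Var[L; μ] ≤ V ∧ f x = L x ∧ ∀ y, L y ≤ f y)
    {r : ℝ} (hr : 0 ≤ r) (h : ℝ) :
    ∫⁻ z, ENNReal.ofReal (Real.exp (r * (Real.cos h * f z.1
        - f (Real.cos h • z.1 + Real.sin h • z.2)))) ∂(μ.prod μ)
      ≤ ENNReal.ofReal (Real.exp (r ^ 2 * Real.sin h ^ 2 * V / 2)) := by
  rw [lintegral_prod _ (by fun_prop)]
  calc _ ≤ ∫⁻ _ : E, ENNReal.ofReal (Real.exp (r ^ 2 * Real.sin h ^ 2 * V / 2)) ∂μ := ?_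
    _ = _ := by simp
  refine lintegral_mono fun x => ?_
  obtain ⟨L, hLV, hLx, hLy⟩ := hf x
  calc _ ≤ ∫⁻ y, ENNReal.ofReal (Real.exp (((-(r * Real.sin h)) • L) y)) ∂μ := by
        refine lintegral_mono fun y => ENNReal.ofReal_le_ofReal (Real.exp_le_exp.2 ?_)
        have := hLy (Real.cos h • x + Real.sin h • y)
        simp only [map_add, map_smul, smul_eq_mul, _root_.smul_apply] at this ⊢
        rw [hLx]
        nlinarith
    _ = _ := lintegral_exp_strongDual hμ _
    _ ≤ _ := by
        refine ENNReal.ofReal_le_ofReal (Real.exp_le_exp.2 ?_)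
        have : Var[((-(r * Real.sin h)) • L : StrongDual ℝ E); μ]
            = (-(r * Real.sin h)) ^ 2 * Var[L; μ] := variance_const_mul _ _ _
        rw [this]
        have := mul_le_mul_of_nonneg_left hLV (sq_nonneg (r * Real.sin h))
        nlinarith

/-- Jensen's inequality for the uniform average of the N numbers N · d k. -/
theorem exp_sum_range_le {N : ℕ} (hN : 0 < N) (d : ℕ → ℝ) :
    Real.exp (∑ k ∈ Finset.range N, d k)
      ≤ ∑ k ∈ Finset.range N, (1 / (N : ℝ)) * Real.exp (N * d k) := by
  have hN' : (N : ℝ) ≠ 0 := by positivity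
  have := convexOn_exp.map_sum_le (t := Finset.range N) (w := fun _ => 1 / (N : ℝ))
    (p := fun k => N * d k) (fun _ _ => by positivity) (by simp [hN']) (fun _ _ => Set.mem_univ _)
  simp only [smul_eq_mul] at this
  refine le_trans (le_of_eq ?_) this
  congr 1
  refine Finset.sum_congr rfl fun k _ => ?_
  field_simp

theorem sum_range_weighted_telescope (c : ℝ) (a : ℕ → ℝ) (N : ℕ) :
    ∑ k ∈ Finset.range N, c ^ (N - 1 - k) * (c * a k - a (k + 1)) = c ^ N * a 0 - a N := by
  have := Finset.sum_range_sub' (fun k => c ^ (N - k) * a k) N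
  simp only [tsub_zero, tsub_self, pow_zero, one_mul] at this
  rw [← this]
  refine Finset.sum_congr rfl fun k hk => ?_
  have hk := Finset.mem_range.1 hk
  rw [show N - k = (N - 1 - k) + 1 by omega, show N - (k + 1) = N - 1 - k by omega]
  ring

/-- A discrete Maurey–Pisier inequality for maxima of linear functionals: rotate from `z.1` to
`z.2` in `N` steps. -/
theorem lintegral_exp_sub_le (hμ : μ[id] = 0) {f : E → ℝ} (hfm : Measurable f) {V : ℝ} (hV : 0 ≤ V)
    (hf : ∀ x, ∃ L : StrongDual ℝ E, Var[L; μ] ≤ V ∧ f x = L x ∧ ∀ y, L y ≤ f y)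
    {r : ℝ} (hr : 0 ≤ r) {N : ℕ} (hN : 0 < N) :
    ∫⁻ z, ENNReal.ofReal (Real.exp (r * (Real.cos (Real.pi / (2 * N)) ^ N * f z.1 - f z.2)))
        ∂(μ.prod μ)
      ≤ ENNReal.ofReal (Real.exp (r ^ 2 * Real.pi ^ 2 * V / 8)) := by
  set h : ℝ := Real.pi / (2 * N) with hh
  have hNpos : (0 : ℝ) < N := by positivity
  have hN1 : (1 : ℝ) ≤ N := by exact_mod_cast hN
  have hh0 : 0 ≤ h := by positivity
  have hh2 : h ≤ Real.pi / 2 := by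
    rw [hh]
    exact div_le_div_of_nonneg_left Real.pi_pos.le (by norm_num) (by linarith)
  have hc0 : 0 ≤ Real.cos h := Real.cos_nonneg_of_mem_Icc ⟨by linarith [Real.pi_pos], hh2⟩
  have hs0 : 0 ≤ Real.sin h := Real.sin_nonneg_of_nonneg_of_le_pi hh0 (by linarith [Real.pi_pos])
  set c := Real.cos h
  -- A quarter circle from z.1 to z.2; the weights `w` make the steps telescope despite the factor c
  -- = cos h in each.
  let Z : ℕ → E × E → E := fun k z => Real.cos (k * h) • z.1 + Real.sin (k * h) • z.2
  let w : ℕ → ℝ := fun k => c ^ (N - 1 - k)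
  have hw0 : ∀ k, 0 ≤ w k := fun k => pow_nonneg hc0 _
  have hw1 : ∀ k, w k ≤ 1 := fun k => pow_le_one₀ hc0 (Real.cos_le_one _)
  have hZm : ∀ k, Measurable (Z k) := fun k => by fun_prop
  let D : ℕ → E × E → ℝ := fun k z => r * (w k * (c * f (Z k z) - f (Z (k + 1) z)))
  have hDm : ∀ k, Measurable (D k) := fun k => by
    have := hfm.comp (hZm k)
    have := hfm.comp (hZm (k + 1))
    simp only [Function.comp_def] at *
    fun_prop
  have htel : ∀ z, r * (c ^ N * f z.1 - f z.2) = ∑ k ∈ Finset.range N, D k z := by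
    intro z
    have := sum_range_weighted_telescope c (fun k => f (Z k z)) N
    have h0 : Z 0 z = z.1 := by simp [Z]
    have h1 : Z N z = z.2 := by
      have : (N : ℝ) * h = Real.pi / 2 := by rw [hh]; field_simp
      simp [Z, this]
    rw [h0, h1] at this
    rw [← this, Finset.mul_sum]
  have hstep : ∀ k, ∫⁻ z, ENNReal.ofReal (Real.exp (N * D k z)) ∂(μ.prod μ)
      ≤ ENNReal.ofReal (Real.exp (r ^ 2 * Real.pi ^ 2 * V / 8)) := by
    intro k
    -- Rotation by kh preserves the product law and sends z.1 to `Z k z`, which reduces step k to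
    -- the one-step bound.
    have hrot := IsGaussian.map_rotation_eq_self hμ (k * h)
    have hg : Measurable fun z : E × E => ENNReal.ofReal (Real.exp ((N * (r * w k)) *
      (Real.cos h * f z.1 - f (Real.cos h • z.1 + Real.sin h • z.2)))) := by fun_prop
    calc _ = ∫⁻ z, ENNReal.ofReal (Real.exp ((N * (r * w k)) *
      (Real.cos h * f z.1 - f (Real.cos h • z.1 + Real.sin h • z.2))))
        ∂((μ.prod μ).map (ContinuousLinearMap.rotation (k * h))) := by
          rw [lintegral_map hg (ContinuousLinearMap.continuous _).measurable]
          refine lintegral_congr fun z => ?_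
          have : Real.cos h • (ContinuousLinearMap.rotation (k * h) z).1
              + Real.sin h • (ContinuousLinearMap.rotation (k * h) z).2 = Z (k + 1) z := by
            simp only [ContinuousLinearMap.rotation_apply, Z]
            push_cast
            rw [add_mul, one_mul, Real.cos_add, Real.sin_add]
            module
          rw [this]
          simp only [ContinuousLinearMap.rotation_apply, D, Z, c]
          congr 2
          ring
      _ ≤ ENNReal.ofReal (Real.exp ((N * (r * w k)) ^ 2 * Real.sin h ^ 2 * V / 2)) := by
          rw [hrot]
          exact lintegral_exp_rotation_step_le hμ hfm hf
            (mul_nonneg hNpos.le (mul_nonneg hr (hw0 k))) h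
      _ ≤ _ := by
          refine ENNReal.ofReal_le_ofReal (Real.exp_le_exp.2 ?_)
          have h1 : N * (r * w k) * Real.sin h ≤ r * (Real.pi / 2) := by
            calc N * (r * w k) * Real.sin h ≤ N * (r * 1) * h := by
                  gcongr
                  · exact hw1 k
                  · exact Real.sin_le hh0
              _ = _ := by rw [hh]; field_simp
          have h2 := pow_le_pow_left₀
            (mul_nonneg (mul_nonneg hNpos.le (mul_nonneg hr (hw0 k))) hs0) h1 2
          have h3 := mul_le_mul_of_nonneg_right h2 hV
          nlinarith
  calc _ ≤ ∫⁻ z, ∑ k ∈ Finset.range N, ENNReal.ofReal (1 / (N : ℝ))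
        * ENNReal.ofReal (Real.exp (N * D k z)) ∂(μ.prod μ) := by
        refine lintegral_mono fun z => ?_
        simp only
        rw [htel z]
        refine (ENNReal.ofReal_le_ofReal (exp_sum_range_le hN _)).trans (le_of_eq ?_)
        rw [ENNReal.ofReal_sum_of_nonneg (fun _ _ => by positivity)]
        exact Finset.sum_congr rfl fun k _ => ENNReal.ofReal_mul (by positivity)
    _ = ∑ k ∈ Finset.range N, ENNReal.ofReal (1 / (N : ℝ))
        * ∫⁻ z, ENNReal.ofReal (Real.exp (N * D k z)) ∂(μ.prod μ) := by
        rw [lintegral_finsetSum _ (fun k _ => by have := hDm k; fun_prop)]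
        refine Finset.sum_congr rfl fun k _ => ?_
        rw [lintegral_const_mul _ (by have := hDm k; fun_prop)]
    _ ≤ ∑ k ∈ Finset.range N, ENNReal.ofReal (1 / (N : ℝ))
        * ENNReal.ofReal (Real.exp (r ^ 2 * Real.pi ^ 2 * V / 8)) := by
        gcongr with k _
        exact hstep k
    _ = _ := by
        rw [← Finset.sum_mul, Finset.sum_const, Finset.card_range, ← ENNReal.ofReal_nsmul]
        have : N • (1 / (N : ℝ)) = 1 := by rw [nsmul_eq_mul]; field_simp
        rw [this]; simp

/-- Bernoulli's inequality with cos x ≥ 1 - x²/2 shows that the loss is at most π²/(8N). -/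
theorem tendsto_cos_pi_div_pow :
    Filter.Tendsto (fun N : ℕ => Real.cos (Real.pi / (2 * N)) ^ N) Filter.atTop (nhds 1) := by
  have hlow : Filter.Tendsto (fun N : ℕ => 1 - Real.pi ^ 2 / 8 * (1 / (N : ℝ)))
      Filter.atTop (nhds 1) := by
    simpa using (tendsto_one_div_atTop_nhds_zero_nat (𝕜 := ℝ)).const_mul (Real.pi ^ 2 / 8)
      |>.const_sub 1
  refine tendsto_of_tendsto_of_tendsto_of_le_of_le' hlow tendsto_const_nhds ?_ ?_
  all_goals filter_upwards [Filter.eventually_ge_atTop 1] with N hN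
  all_goals
    have hN1 : (1 : ℝ) ≤ N := by exact_mod_cast hN
    have hc0 : 0 ≤ Real.cos (Real.pi / (2 * N)) := by
      refine Real.cos_nonneg_of_mem_Icc ⟨?_, ?_⟩
      · have : 0 ≤ Real.pi / (2 * N) := by positivity
        linarith [Real.pi_pos]
      · exact div_le_div_of_nonneg_left Real.pi_pos.le (by norm_num) (by linarith)
  · have h1 := one_add_mul_le_pow (a := Real.cos (Real.pi / (2 * N)) - 1) (by linarith) N
    have h2 := Real.one_sub_sq_div_two_le_cos (x := Real.pi / (2 * N))
    have h3 : (N : ℝ) * ((Real.pi / (2 * N)) ^ 2 / 2) = Real.pi ^ 2 / 8 * (1 / (N : ℝ)) := by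
      field_simp; norm_num
    have h4 : (N : ℝ) * -((Real.pi / (2 * N)) ^ 2 / 2)
        ≤ N * (Real.cos (Real.pi / (2 * N)) - 1) := by
      gcongr; linarith
    rw [add_sub_cancel] at h1
    linarith
  · exact pow_le_one₀ hc0 (Real.cos_le_one _)

/-- Gaussian concentration for a maximum `f` of linear functionals of variance at most `V`:
the measures of two separated super- and sublevel sets cannot both be large. -/
theorem measure_superlevel_mul_sublevel_le (hμ : μ[id] = 0) {f : E → ℝ} (hfm : Measurable f) {V : ℝ}
    (hV : 0 < V)
    (hf : ∀ x, ∃ L : StrongDual ℝ E, Var[L; μ] ≤ V ∧ f x = L x ∧ ∀ y, L y ≤ f y)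
    {s t : ℝ} (hst : t ≤ s) :
    μ.real {x | s < f x} * μ.real {x | f x ≤ t}
      ≤ Real.exp (-(2 * (s - t) ^ 2 / (Real.pi ^ 2 * V))) := by
  have hpi := Real.pi_pos
  -- Minimizer of r²π²V/8 - r(s - t), the limiting exponent.
  set r : ℝ := 4 * (s - t) / (Real.pi ^ 2 * V) with hrdef
  have hr : 0 ≤ r := div_nonneg (by linarith) (by positivity)
  have hsA : MeasurableSet {x | s < f x} := measurableSet_lt measurable_const hfm
  have hsB : MeasurableSet {x | f x ≤ t} := measurableSet_le hfm measurable_const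
  have hbound : ∀ᶠ N : ℕ in Filter.atTop, μ.real {x | s < f x} * μ.real {x | f x ≤ t}
      ≤ Real.exp (r ^ 2 * Real.pi ^ 2 * V / 8
        - r * (Real.cos (Real.pi / (2 * N)) ^ N * s - t)) := by
    filter_upwards [Filter.eventually_ge_atTop 1] with N hN
    have hN1 : (1 : ℝ) ≤ N := by exact_mod_cast hN
    set c := Real.cos (Real.pi / (2 * N)) ^ N
    have hc0 : 0 ≤ c := by
      refine pow_nonneg (Real.cos_nonneg_of_mem_Icc ⟨?_, ?_⟩) _
      · have : 0 ≤ Real.pi / (2 * N) := by positivity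
        linarith [Real.pi_pos]
      · exact div_le_div_of_nonneg_left Real.pi_pos.le (by norm_num) (by linarith)
    have h1 : ENNReal.ofReal (Real.exp (r * (c * s - t))) * (μ.prod μ)
        ({x | s < f x} ×ˢ {x | f x ≤ t})
        ≤ ENNReal.ofReal (Real.exp (r ^ 2 * Real.pi ^ 2 * V / 8)) := by
      refine le_trans ?_ (lintegral_exp_sub_le hμ hfm hV.le hf hr (N := N) hN)
      rw [← setLIntegral_const]
      refine (setLIntegral_mono' (hsA.prod hsB) fun z hz => ?_).trans (setLIntegral_le_lintegral _ _)
      refine ENNReal.ofReal_le_ofReal (Real.exp_le_exp.2 (mul_le_mul_of_nonneg_left ?_ hr))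
      have hz1 : s < f z.1 := hz.1
      have hz2 : f z.2 ≤ t := hz.2
      have := mul_le_mul_of_nonneg_left hz1.le hc0
      linarith
    rw [Measure.prod_prod] at h1
    have h2 := ENNReal.toReal_mono ENNReal.ofReal_ne_top h1
    rw [ENNReal.toReal_mul, ENNReal.toReal_mul, ENNReal.toReal_ofReal (Real.exp_pos _).le,
      ENNReal.toReal_ofReal (Real.exp_pos _).le] at h2
    rw [Real.exp_sub, le_div_iff₀ (Real.exp_pos _), mul_comm]
    exact h2
  have hlim : Filter.Tendsto (fun N : ℕ => Real.exp (r ^ 2 * Real.pi ^ 2 * V / 8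
        - r * (Real.cos (Real.pi / (2 * N)) ^ N * s - t))) Filter.atTop
      (nhds (Real.exp (r ^ 2 * Real.pi ^ 2 * V / 8 - r * (1 * s - t)))) :=
    (Real.continuous_exp.tendsto _).comp
      ((((tendsto_cos_pi_div_pow.mul_const s).sub_const t).const_mul r).const_sub _)
  refine (ge_of_tendsto hlim hbound).trans (le_of_eq ?_)
  congr 1
  rw [hrdef]
  field_simp
  ring

end GaussianConcentration

/-! ### Rearrangement and the deterministic bound by H. -/

namespace StochasticError

theorem absSorted_nonneg {p : ℕ} (u : Fin p → ℝ) (j : Fin p) : 0 ≤ absSorted u j := abs_nonneg _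

theorem sum_mul_le_sum_absSorted_mul {p : ℕ} (g u : Fin p → ℝ) :
    ∑ k, g k * u k ≤ ∑ j, absSorted g j * absSorted u j := by
  let φ := Tuple.sort (fun i => -|g i|)
  let ψ := Tuple.sort (fun i => -|u i|)
  calc ∑ k, g k * u k ≤ ∑ k, |g k| * |u k| :=
        Finset.sum_le_sum fun k _ => (le_abs_self _).trans (abs_mul _ _).le
    _ = ∑ j, |g (φ j)| * |u (φ j)| := (Equiv.sum_comp φ fun k => |g k| * |u k|).symm
    _ = ∑ j, absSorted g j * absSorted u ((φ.trans ψ.symm) j) := by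
        refine Finset.sum_congr rfl fun j _ => ?_
        simp [absSorted, φ, ψ]
    _ ≤ _ := Monovary.sum_mul_comp_perm_le_sum_mul
        ((absSorted_antitone g).monovary (absSorted_antitone u))

/-- The j + 1 largest terms of the sum are each at least exp(b (gⱼ♯)²). -/
theorem absSorted_sq_le_log {p : ℕ} (g : Fin p → ℝ) {b K : ℝ} (hb : 0 < b)
    (hg : ∑ k, Real.exp (b * g k ^ 2) ≤ K) (j : Fin p) :
    b * absSorted g j ^ 2 ≤ Real.log (K / ((j : ℝ) + 1)) := by
  obtain ⟨φ, hφ⟩ := exists_perm_absSorted g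
  have h1 : ((j : ℝ) + 1) * Real.exp (b * absSorted g j ^ 2) ≤ K := by
    calc ((j : ℝ) + 1) * Real.exp (b * absSorted g j ^ 2)
        = ∑ _i ∈ Finset.Iic j, Real.exp (b * absSorted g j ^ 2) := by
          simp
      _ ≤ ∑ i ∈ Finset.Iic j, Real.exp (b * absSorted g i ^ 2) := by
          refine Finset.sum_le_sum fun i hi => ?_
          have := absSorted_antitone g (Finset.mem_Iic.1 hi)
          have := absSorted_nonneg g j
          gcongr
      _ ≤ ∑ i, Real.exp (b * absSorted g i ^ 2) :=
          Finset.sum_le_univ_sum_of_nonneg fun i => (Real.exp_pos _).le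
      _ = ∑ i, Real.exp (b * g (φ i) ^ 2) := by simp [hφ]
      _ = ∑ k, Real.exp (b * g k ^ 2) := Equiv.sum_comp φ fun k => Real.exp (b * g k ^ 2)
      _ ≤ K := hg
  have hj : (0 : ℝ) < (j : ℝ) + 1 := by positivity
  rw [← Real.log_exp (b * absSorted g j ^ 2)]
  refine Real.log_le_log (Real.exp_pos _) ?_
  rw [le_div_iff₀ hj]
  linarith

/-- With r = p/(j+1) ≥ 1, one has 2^m r ≤ (2r)^m. -/
theorem log_two_pow_mul_div_le {p : ℕ} (j : Fin p) {m : ℕ} (hm : 1 ≤ m) :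
    Real.log (2 ^ m * p / ((j : ℝ) + 1)) ≤ m * Real.log (2 * p / ((j : ℝ) + 1)) := by
  have hj : (0 : ℝ) < (j : ℝ) + 1 := by positivity
  have hjp : (j : ℝ) + 1 ≤ p := by exact_mod_cast j.2
  have hp : (0 : ℝ) < p := by linarith
  have hr : 1 ≤ (p : ℝ) / ((j : ℝ) + 1) := (one_le_div hj).2 hjp
  rw [← Real.log_pow]
  refine Real.log_le_log (by positivity) ?_
  rw [mul_div_assoc, mul_div_assoc, mul_pow]
  gcongr
  exact le_self_pow₀ hr (by omega)

theorem log_two_mul_div_pos {p : ℕ} (j : Fin p) : 0 < Real.log (2 * p / ((j : ℝ) + 1)) := by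
  have hjp : (j : ℝ) + 1 ≤ p := by exact_mod_cast j.2
  have hj : (0 : ℝ) < (j : ℝ) + 1 := by positivity
  refine Real.log_pos ((one_lt_div hj).2 (by linarith))

theorem H_pos {n p : ℕ} (hn : 1 ≤ n) {σ : ℝ} (hσ : 0 < σ) {u : Fin p → ℝ} (hu : u ≠ 0) :
    0 < H n σ u := by
  obtain ⟨k, hk⟩ := Function.ne_iff.1 hu
  have hw : ∀ j : Fin p, 0 < σ * √(Real.log (2 * (p : ℝ) / ((j : ℝ) + 1)) / (n : ℝ)) := fun j =>
    mul_pos hσ (Real.sqrt_pos.2 (div_pos (log_two_mul_div_pos j) (by exact_mod_cast hn)))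
  refine mul_pos (by positivity) (Finset.sum_pos' (fun j _ => mul_nonneg (absSorted_nonneg u j)
    (hw j).le) ⟨(Tuple.sort fun i => -|u i|).symm k, Finset.mem_univ _, mul_pos ?_ (hw _)⟩)
  simpa [absSorted] using hk

/-- If the exponential moments of the squares `gₖ²` are controlled, then `⟨g, u⟩ / √n` is bounded
by a multiple of `H(u)`, uniformly in `u`. -/
theorem sum_mul_div_sqrt_le_H {n p : ℕ} (hn : 1 ≤ n) {σ : ℝ} (hσ : 0 < σ) (g : Fin p → ℝ)
    {m : ℕ} (hm : 1 ≤ m) (hg : ∑ k, Real.exp (3 / (8 * σ ^ 2) * g k ^ 2) ≤ 2 ^ m * p)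
    (u : Fin p → ℝ) :
    (∑ k, g k * u k) / √n ≤ √(8 * m / 3) / (4 + √2) * H n σ u := by
  have hb : 0 < 3 / (8 * σ ^ 2) := by positivity
  have hs2 : (0 : ℝ) < 4 + √2 := by positivity
  have hn0 : (0 : ℝ) < n := by exact_mod_cast hn
  have hgj : ∀ j, absSorted g j
      ≤ √(8 * m / 3) * σ * √(Real.log (2 * (p : ℝ) / ((j : ℝ) + 1))) := by
    intro j
    have h1 := (absSorted_sq_le_log g hb hg j).trans (log_two_pow_mul_div_le j hm)
    have hl := (log_two_mul_div_pos j).le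
    refine (abs_le_of_sq_le_sq' ?_ (by positivity)).2
    rw [mul_pow, mul_pow, Real.sq_sqrt (by positivity), Real.sq_sqrt hl]
    rw [div_mul_eq_mul_div, div_le_iff₀ (by positivity)] at h1
    nlinarith
  rw [div_le_iff₀ (by positivity)]
  refine (sum_mul_le_sum_absSorted_mul g u).trans ?_
  have : √(8 * m / 3) / (4 + √2) * H n σ u * √n = ∑ j : Fin p,
      (√(8 * m / 3) * σ * √(Real.log (2 * (p : ℝ) / ((j : ℝ) + 1)))) * absSorted u j := by
    rw [H, ← mul_assoc, div_mul_cancel₀ _ hs2.ne', Finset.mul_sum, Finset.sum_mul]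
    refine Finset.sum_congr rfl fun j _ => ?_
    rw [Real.sqrt_div (log_two_mul_div_pos j).le]
    field_simp
  rw [this]
  exact Finset.sum_le_sum fun j _ => mul_le_mul_of_nonneg_right (hgj j) (absSorted_nonneg u j)

end StochasticError

/-! ### Exponential moment of a squared Gaussian; unions of open sets. -/

/-- When s = v > 0, the factor turns exp(-x²/(2v)) into exp(-x²/(8v)), multiplying the variance by 4
and hence the integral by √4 = 2. -/
theorem lintegral_exp_sq_gaussianReal_le {s : ℝ} {v : NNReal} (hv : (v : ℝ) ≤ s) :
    ∫⁻ x, ENNReal.ofReal (Real.exp (3 / (8 * s) * x ^ 2)) ∂(gaussianReal 0 v) ≤ 2 := by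
  rcases eq_or_ne v 0 with rfl | hv0
  · rw [gaussianReal_zero_var, lintegral_dirac' _ (by fun_prop)]
    norm_num
  have hvpos : (0 : ℝ) < v := by positivity
  have hpi := Real.pi_pos
  rw [gaussianReal_of_var_ne_zero _ hv0,
    lintegral_withDensity_eq_lintegral_mul _ (measurable_gaussianPDF 0 v) (by fun_prop)]
  have hint : Integrable fun x : ℝ => (√(2 * Real.pi * v))⁻¹ * Real.exp (-(1 / (8 * v)) * x ^ 2) :=
    (integrable_exp_neg_mul_sq (by positivity)).const_mul _
  calc _ ≤ ∫⁻ x, ENNReal.ofReal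
        ((√(2 * Real.pi * v))⁻¹ * Real.exp (-(1 / (8 * v)) * x ^ 2)) := by
        refine lintegral_mono fun x => ?_
        rw [Pi.mul_apply, gaussianPDF, ← ENNReal.ofReal_mul (gaussianPDFReal_nonneg _ _ _),
          gaussianPDFReal, mul_assoc, ← Real.exp_add]
        refine ENNReal.ofReal_le_ofReal
          (mul_le_mul_of_nonneg_left (Real.exp_le_exp.2 ?_) (by positivity))
        have h1 : 3 / (8 * s) * x ^ 2 ≤ 3 / (8 * v) * x ^ 2 := by gcongr
        have h2 : -(x - 0) ^ 2 / (2 * v) + 3 / (8 * v) * x ^ 2 = -(1 / (8 * v)) * x ^ 2 := by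
          field_simp; ring
        linarith
    _ = ENNReal.ofReal 2 := by
        rw [← ofReal_integral_eq_lintegral_ofReal hint (ae_of_all _ fun x => by positivity),
          integral_const_mul, integral_gaussian]
        congr 1
        have : Real.pi / (1 / (8 * v)) = 2 ^ 2 * (2 * Real.pi * v) := by field_simp; norm_num
        rw [this, Real.sqrt_mul (x := 2 ^ 2) (by norm_num), Real.sqrt_sq (by norm_num)]
        have : √(2 * Real.pi * v) ≠ 0 := by positivity
        field_simp
    _ = 2 := by simp

/-- The Lindelöf property gives a countable subcover, and continuity from below reduces it to finite
unions. -/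
theorem measure_iUnion_le_of_isOpen {α ι : Type*} [TopologicalSpace α] [SecondCountableTopology α]
    [MeasurableSpace α] (μ : Measure α) {s : ι → Set α} (hs : ∀ i, IsOpen (s i)) {C : ENNReal}
    (h : ∀ F : Finset ι, μ (⋃ i ∈ F, s i) ≤ C) : μ (⋃ i, s i) ≤ C := by
  classical
  obtain ⟨T, hTc, hT⟩ := TopologicalSpace.isOpen_iUnion_countable s hs
  rw [← hT]
  rcases T.eq_empty_or_nonempty with rfl | hne
  · simp
  obtain ⟨e, rfl⟩ := hTc.exists_eq_range hne
  rw [Set.biUnion_range, measure_iUnion_eq_iSup_accumulate]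
  refine iSup_le fun k => le_trans (measure_mono ?_) (h ((Finset.range (k + 1)).image e))
  intro x hx
  obtain ⟨i, hi, hx⟩ := Set.mem_accumulate.1 hx
  exact Set.mem_biUnion (Finset.mem_image_of_mem e (Finset.mem_range.2 (by omega))) hx

/-! ### Probability bounds for 𝒩(0, σ²I). -/

namespace StochasticError

section Gaussian

variable {n p : ℕ} {σ : ℝ}

/-- The isotropic Gaussian distribution `𝒩(0, σ² I)` on `ℝⁿ`. -/
noncomputable abbrev isotropicGaussian (n : ℕ) (σ : ℝ) : Measure (EuclideanSpace ℝ (Fin n)) :=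
  multivariateGaussian 0 (σ ^ 2 • (1 : Matrix (Fin n) (Fin n) ℝ))

/-- The functional `x ↦ ⟨x, a⟩`. -/
noncomputable def dotDual (a : Fin n → ℝ) : StrongDual ℝ (EuclideanSpace ℝ (Fin n)) :=
  innerSL ℝ (WithLp.toLp 2 a)

theorem dotDual_apply (a : Fin n → ℝ) (x : EuclideanSpace ℝ (Fin n)) :
    dotDual a x = x.ofLp ⬝ᵥ a := by
  simp [dotDual, EuclideanSpace.inner_eq_star_dotProduct]

theorem variance_dotDual (a : Fin n → ℝ) :
    Var[dotDual a; isotropicGaussian n σ] = σ ^ 2 * ∑ i, a i ^ 2 := by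
  have hS : (σ ^ 2 • (1 : Matrix (Fin n) (Fin n) ℝ)).PosSemidef :=
    Matrix.PosSemidef.one.smul (sq_nonneg σ)
  have h := covarianceBilin_self (μ := isotropicGaussian n σ) IsGaussian.memLp_two_id
    (WithLp.toLp 2 a)
  rw [covarianceBilin_multivariateGaussian hS] at h
  refine Eq.trans ?_ (h.symm.trans ?_)
  · rfl
  · rw [smul_mulVec, one_mulVec, dotProduct_smul, smul_eq_mul, dotProduct]
    simp_rw [pow_two]

theorem sum_sq_eq_empNorm (hn : 1 ≤ n) (v : Fin n → ℝ) : ∑ i, v i ^ 2 = n * empNorm v ^ 2 := by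
  have hn0 : (0 : ℝ) < n := by exact_mod_cast hn
  rw [empNorm, Real.sq_sqrt (mul_nonneg (by positivity)
    (Finset.sum_nonneg fun i _ => sq_nonneg _))]
  field_simp

theorem lintegral_exp_sq_column_le (hn : 1 ≤ n) {v : Fin n → ℝ} (hv : empNorm v ≤ 1) :
    ∫⁻ x, ENNReal.ofReal (Real.exp (3 / (8 * σ ^ 2) * ((x.ofLp ⬝ᵥ v) / √n) ^ 2))
      ∂(isotropicGaussian n σ) ≤ 2 := by
  have hn0 : (0 : ℝ) < n := by exact_mod_cast hn
  set L := dotDual ((√n)⁻¹ • v)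
  have hL : ∀ x : EuclideanSpace ℝ (Fin n), (x.ofLp ⬝ᵥ v) / √n = L x := fun x => by
    rw [dotDual_apply, dotProduct_smul, smul_eq_mul, div_eq_inv_mul]
  have hVar : Var[L; isotropicGaussian n σ] ≤ σ ^ 2 := by
    rw [variance_dotDual]
    have : ∑ i, ((√n)⁻¹ • v) i ^ 2 = empNorm v ^ 2 := by
      simp only [Pi.smul_apply, smul_eq_mul, mul_pow, inv_pow, Real.sq_sqrt hn0.le]
      rw [← Finset.mul_sum, sum_sq_eq_empNorm hn]
      field_simp
    rw [this]
    have h0 : 0 ≤ empNorm v := Real.sqrt_nonneg _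
    exact mul_le_of_le_one_right (sq_nonneg σ) (pow_le_one₀ h0 hv)
  simp_rw [hL]
  rw [← lintegral_map (f := fun y => ENNReal.ofReal (Real.exp (3 / (8 * σ ^ 2) * y ^ 2)))
    (by fun_prop) L.continuous.measurable,
    map_strongDual_eq_gaussianReal integral_id_multivariateGaussian']
  refine lintegral_exp_sq_gaussianReal_le ?_
  rwa [Real.coe_toNNReal _ (variance_nonneg _ _)]

/-- The event on which the exponential moments of the squared correlations with the columns of
`X` exceed the level `2 ^ m`. -/
def largeCorrelations (X : Matrix (Fin n) (Fin p) ℝ) (σ : ℝ) (m : ℕ) :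
    Set (EuclideanSpace ℝ (Fin n)) :=
  {x | 2 ^ m * (p : ℝ)
    < ∑ k, Real.exp (3 / (8 * σ ^ 2) * ((x.ofLp ⬝ᵥ (X *ᵥ Pi.single k 1)) / √n) ^ 2)}

variable {X : Matrix (Fin n) (Fin p) ℝ}

theorem continuous_dotProduct_ofLp (v : Fin n → ℝ) :
    Continuous fun x : EuclideanSpace ℝ (Fin n) => x.ofLp ⬝ᵥ v := by
  exact (dotDual v).continuous.congr (dotDual_apply v)

theorem measurableSet_largeCorrelations (m : ℕ) : MeasurableSet (largeCorrelations X σ m) := by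
  have := fun k => (continuous_dotProduct_ofLp (X *ᵥ Pi.single k 1)).measurable
  exact measurableSet_lt measurable_const (by fun_prop)

theorem measure_largeCorrelations_le (hn : 1 ≤ n) (hp : 1 ≤ p)
    (hX : ∀ j : Fin p, empNorm (X *ᵥ Pi.single j (1 : ℝ)) ≤ 1) (m : ℕ) :
    (isotropicGaussian n σ).real (largeCorrelations X σ m) ≤ 2 / 2 ^ m := by
  set μ := isotropicGaussian n σ
  have hp0 : (0 : ℝ) < p := by exact_mod_cast hp
  let g : Fin p → EuclideanSpace ℝ (Fin n) → ℝ := fun k x =>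
    Real.exp (3 / (8 * σ ^ 2) * ((x.ofLp ⬝ᵥ (X *ᵥ Pi.single k 1)) / √n) ^ 2)
  have hgm : ∀ k, Measurable (g k) := fun k => by
    have := (continuous_dotProduct_ofLp (X *ᵥ Pi.single k 1)).measurable
    fun_prop
  have hε : (0 : ℝ) < 2 ^ m * p := by positivity
  have h1 : ENNReal.ofReal (2 ^ m * p) * μ (largeCorrelations X σ m) ≤ ENNReal.ofReal (p * 2) := by
    calc _ ≤ ENNReal.ofReal (2 ^ m * p) *
          μ {x | ENNReal.ofReal (2 ^ m * p) ≤ ∑ k, ENNReal.ofReal (g k x)} := by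
          gcongr
          intro x hx
          have hx : 2 ^ m * (p : ℝ) < ∑ k, g k x := hx
          rw [Set.mem_ofPred_eq]
          rw [← ENNReal.ofReal_sum_of_nonneg fun k _ => (Real.exp_pos _).le]
          exact ENNReal.ofReal_le_ofReal hx.le
      _ ≤ ∫⁻ x, ∑ k, ENNReal.ofReal (g k x) ∂μ := by
          refine mul_meas_ge_le_lintegral ?_ _
          fun_prop
      _ = ∑ k, ∫⁻ x, ENNReal.ofReal (g k x) ∂μ := lintegral_finsetSum _ (fun k _ => by fun_prop)
      _ ≤ ∑ _k : Fin p, 2 :=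
          Finset.sum_le_sum fun k _ => lintegral_exp_sq_column_le hn (hX k)
      _ = _ := by
          rw [ENNReal.ofReal_mul hp0.le]
          simp
  have h2 := ENNReal.toReal_mono ENNReal.ofReal_ne_top h1
  rw [ENNReal.toReal_mul, ENNReal.toReal_ofReal hε.le, ENNReal.toReal_ofReal (by positivity)] at h2
  rw [le_div_iff₀ (by positivity)]
  have h3 : p * (μ.real (largeCorrelations X σ m) * 2 ^ m) ≤ p * 2 := by
    rw [Measure.real]
    linarith
  exact le_of_mul_le_mul_left h3 hp0

theorem dotProduct_mulVec_le_H (hn : 1 ≤ n) (hσ : 0 < σ) {m : ℕ} (hm : 1 ≤ m)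
    {x : EuclideanSpace ℝ (Fin n)} (hx : x ∉ largeCorrelations X σ m) (u : Fin p → ℝ) :
    (1 / (n : ℝ)) * (x.ofLp ⬝ᵥ (X *ᵥ u)) ≤ √(8 * m / 3) / (4 + √2) * H n σ u := by
  have hn0 : (0 : ℝ) < n := by exact_mod_cast hn
  refine le_trans (le_of_eq ?_) (sum_mul_div_sqrt_le_H hn hσ _ hm (not_lt.1 hx) u)
  have : ∀ k, x.ofLp ⬝ᵥ (X *ᵥ Pi.single k 1) = (x.ofLp ᵥ* X) k := fun k => by
    rw [dotProduct_mulVec, dotProduct_single_one]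
  simp_rw [this]
  rw [dotProduct_mulVec, dotProduct, Finset.mul_sum, Finset.sum_div]
  refine Finset.sum_congr rfl fun k _ => ?_
  nth_rw 1 [← Real.mul_self_sqrt hn0.le]
  field_simp

/-- The event that the bound on the stochastic error fails at `u`. -/
def violation (X : Matrix (Fin n) (Fin p) ℝ) (σ δ₀ : ℝ) (u : Fin p → ℝ) :
    Set (EuclideanSpace ℝ (Fin n)) :=
  {x | max (H n σ u) (G X σ δ₀ u) < (1 / (n : ℝ)) * (x.ofLp ⬝ᵥ (X *ᵥ u))}

theorem isOpen_violation (δ₀ : ℝ) (u : Fin p → ℝ) : IsOpen (violation X σ δ₀ u) :=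
  isOpen_lt continuous_const ((continuous_dotProduct_ofLp _).const_mul _)

theorem violation_zero (δ₀ : ℝ) :
    violation X σ δ₀ (0 : Fin p → ℝ) = ∅ := by
  have : H n σ (0 : Fin p → ℝ) = 0 := by simp [H, absSorted]
  ext x
  simp [violation, this]

/-- This is δ₀^(3/2) ≤ δ₀/4, that is √δ₀ ≤ 1/4. -/
theorem exp_neg_log_le {δ₀ : ℝ} (hδ₀ : 0 < δ₀) (hδ : δ₀ < 1 / 16) :
    Real.exp (-(3 / 2 * Real.log (1 / δ₀))) ≤ δ₀ / 4 := by
  have h1 : Real.log δ₀ ≤ -(2 * Real.log 4) := by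
    have : -(2 * Real.log 4) = Real.log (1 / 16) := by
      rw [show (1 / 16 : ℝ) = (4 ^ 2)⁻¹ by norm_num, Real.log_inv, Real.log_pow]
      norm_num
    rw [this]
    exact Real.log_le_log hδ₀ hδ.le
  have h2 : δ₀ / 4 = Real.exp (Real.log δ₀ - Real.log 4) := by
    rw [Real.exp_sub, Real.exp_log hδ₀, Real.exp_log (by norm_num)]
  rw [h2, one_div, Real.log_inv]
  exact Real.exp_le_exp.2 (by linarith)

/-- The deviation bound on a finite set of directions, for small `δ₀`, by concentration of the
maximum of the normalized correlations. -/
theorem measure_violation_finset_le (hn : 1 ≤ n) (hp : 1 ≤ p) (hσ : 0 < σ)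
    (hX : ∀ j : Fin p, empNorm (X *ᵥ Pi.single j (1 : ℝ)) ≤ 1)
    {δ₀ : ℝ} (hδ₀ : 0 < δ₀) (hδ : δ₀ < 1 / 16) (F : Finset {u : Fin p → ℝ // u ≠ 0}) :
    (isotropicGaussian n σ).real (⋃ u ∈ F, violation X σ δ₀ u) ≤ δ₀ / 2 := by
  set μ := isotropicGaussian n σ
  have hn0 : (0 : ℝ) < n := by exact_mod_cast hn
  rcases F.eq_empty_or_nonempty with rfl | hF
  · simp only [Finset.notMem_empty, Set.iUnion_of_empty, Set.iUnion_empty, measureReal_empty]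
    positivity
  set K : ℝ := 4 + √2 with hKdef
  have hK : 0 < K := by positivity
  set ℓ := Real.log (1 / δ₀) with hℓdef
  have hℓ : 0 < ℓ := Real.log_pos ((one_lt_div hδ₀).2 (by linarith))
  let M : (Fin p → ℝ) → ℝ := fun u => max (H n σ u) (G X σ δ₀ u)
  have hHM : ∀ u, H n σ u ≤ M u := fun u => le_max_left _ _
  have hM : ∀ u : {u : Fin p → ℝ // u ≠ 0}, 0 < M u := fun u => (H_pos hn hσ u.2).trans_le (hHM u)
  let a : {u : Fin p → ℝ // u ≠ 0} → StrongDual ℝ (EuclideanSpace ℝ (Fin n)) := fun u =>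
    dotDual ((1 / (n * M u)) • (X *ᵥ u))
  have ha : ∀ u x, a u x = (1 / (n : ℝ)) * (x.ofLp ⬝ᵥ (X *ᵥ u)) / M u := fun u x => by
    simp only [a]
    rw [dotDual_apply, dotProduct_smul, smul_eq_mul]
    field_simp
  set V : ℝ := 1 / (K ^ 2 * ℓ) with hVdef
  have hV : 0 < V := by positivity
  have haV : ∀ u, Var[a u; μ] ≤ V := by
    intro u
    simp only [a]
    rw [variance_dotDual]
    simp only [Pi.smul_apply, smul_eq_mul, mul_pow]
    rw [← Finset.mul_sum, sum_sq_eq_empNorm hn]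
    have hG : G X σ δ₀ u ≤ M u := le_max_right _ _
    have hG0 : 0 ≤ G X σ δ₀ u := by
      unfold G
      have : 0 ≤ empNorm (X *ᵥ (u : Fin p → ℝ)) := Real.sqrt_nonneg _
      positivity
    have hG2 : G X σ δ₀ u ^ 2 = K ^ 2 * σ ^ 2 * (ℓ / n) * empNorm (X *ᵥ (u : Fin p → ℝ)) ^ 2 := by
      rw [G, mul_pow, mul_pow, mul_pow, Real.sq_sqrt (by positivity)]
    have h1 := pow_le_pow_left₀ hG0 hG 2
    rw [hG2] at h1
    have hMu := hM u
    rw [hVdef, le_div_iff₀ (by positivity)]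
    calc _ = (K ^ 2 * σ ^ 2 * (ℓ / n) * empNorm (X *ᵥ (u : Fin p → ℝ)) ^ 2) / M u ^ 2 := by
          field_simp
      _ ≤ 1 := (div_le_one (by positivity)).2 h1
  let f : EuclideanSpace ℝ (Fin n) → ℝ := fun x => F.sup' hF fun u => a u x
  have hfc : Continuous f := Continuous.finset_sup'_apply hF fun u _ => (a u).continuous
  have hf : ∀ x, ∃ L : StrongDual ℝ (EuclideanSpace ℝ (Fin n)),
      Var[L; μ] ≤ V ∧ f x = L x ∧ ∀ y, L y ≤ f y := by
    intro x
    obtain ⟨u, hu, hux⟩ := Finset.exists_mem_eq_sup' hF fun u => a u x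
    exact ⟨a u, haV u, hux, fun y => Finset.le_sup' (fun u => a u y) hu⟩
  -- Level m = 2: the exceptional probability 2/2^m is then 1/2.
  set τ : ℝ := √(8 * (2 : ℕ) / 3) with hτdef
  have hτ : τ ≤ 2.31 := by
    rw [hτdef, Real.sqrt_le_left (by norm_num)]
    norm_num
  have hs2 : 1.41 ≤ √2 := Real.le_sqrt_of_sq_le (by norm_num)
  have hKτ : 3.1 ≤ K - τ := by rw [hKdef]; linarith
  have hconc := measure_superlevel_mul_sublevel_le (μ := μ) integral_id_multivariateGaussian' hfc.measurable hV
    hf (s := 1) (t := τ / K) ((div_le_one hK).2 (by linarith))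
  have hbad : ⋃ u ∈ F, violation X σ δ₀ u ⊆ {x | 1 < f x} := by
    intro x hx
    simp only [Set.mem_iUnion] at hx
    obtain ⟨u, hu, hux⟩ := hx
    refine lt_of_lt_of_le (b := a u x) ?_ (Finset.le_sup' (fun u => a u x) hu)
    rw [ha]
    exact (one_lt_div (hM u)).2 hux
  have hgood : (largeCorrelations X σ 2)ᶜ ⊆ {x | f x ≤ τ / K} := by
    intro x hx
    change f x ≤ τ / K
    refine Finset.sup'_le hF (fun u => a u x) fun u _ => ?_
    rw [ha, div_le_iff₀ (hM u)]
    refine (dotProduct_mulVec_le_H hn hσ one_le_two hx u).trans ?_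
    exact mul_le_mul_of_nonneg_left (hHM u) (by positivity)
  have hhalf : 1 / 2 ≤ μ.real {x | f x ≤ τ / K} := by
    refine le_trans ?_ (measureReal_mono hgood)
    rw [probReal_compl_eq_one_sub (measurableSet_largeCorrelations 2)]
    have := measure_largeCorrelations_le (σ := σ) hn hp hX 2
    norm_num at this
    linarith
  have hexp : Real.exp (-(2 * (1 - τ / K) ^ 2 / (Real.pi ^ 2 * V)))
      ≤ Real.exp (-(3 / 2 * ℓ)) := by
    refine Real.exp_le_exp.2 (neg_le_neg ?_)
    have hpi := Real.pi_pos
    have hpi2 := Real.pi_lt_d2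
    have h1 : 2 * (1 - τ / K) ^ 2 / (Real.pi ^ 2 * V) = 2 * (K - τ) ^ 2 / Real.pi ^ 2 * ℓ := by
      rw [hVdef]; field_simp
    rw [h1]
    refine mul_le_mul_of_nonneg_right ?_ hℓ.le
    rw [le_div_iff₀ (by positivity)]
    -- 2 · 3.1² / π² exceeds 3/2, using π < 3.15.
    nlinarith
  have hfin := hconc.trans (hexp.trans (exp_neg_log_le hδ₀ hδ))
  have hx1 := measureReal_mono (μ := μ) hbad
  have hx0 : 0 ≤ μ.real {x | 1 < f x} := measureReal_nonneg
  nlinarith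

theorem measure_iUnion_violation_le (hn : 1 ≤ n) (hp : 1 ≤ p) (hσ : 0 < σ)
    (hX : ∀ j : Fin p, empNorm (X *ᵥ Pi.single j (1 : ℝ)) ≤ 1) {δ₀ : ℝ} (hδ₀ : 0 < δ₀) :
    (isotropicGaussian n σ).real (⋃ u, violation X σ δ₀ u) ≤ δ₀ / 2 := by
  rcases lt_or_ge δ₀ (1 / 16) with hδ | hδ
  · have hU : ⋃ u, violation X σ δ₀ u
        = ⋃ u : {u : Fin p → ℝ // u ≠ 0}, violation X σ δ₀ u := by
      refine subset_antisymm (Set.iUnion_subset fun u => ?_)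
        (Set.iUnion_subset fun u => Set.subset_iUnion _ u.1)
      rcases eq_or_ne u 0 with rfl | hu
      · simp [violation_zero]
      · exact fun x hx => Set.mem_iUnion.2 ⟨⟨u, hu⟩, hx⟩
    rw [hU]
    refine ENNReal.toReal_le_of_le_ofReal (by positivity) ?_
    refine measure_iUnion_le_of_isOpen (isotropicGaussian n σ)
      (s := fun u : {u : Fin p → ℝ // u ≠ 0} => violation X σ δ₀ u.1)
      (fun u => isOpen_violation δ₀ u.1) fun F => ?_
    rw [← ENNReal.toReal_le_toReal (measure_ne_top _ _) ENNReal.ofReal_ne_top,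
      ENNReal.toReal_ofReal (by positivity)]
    exact measure_violation_finset_le hn hp hσ hX hδ₀ hδ F
  -- Level m = 6: √(8m/3) = 4 ≤ 4 + √2, and 2/2^6 = 1/32 ≤ δ₀/2.
  · have hsub : ⋃ u, violation X σ δ₀ u ⊆ largeCorrelations X σ 6 := by
      refine Set.iUnion_subset fun u x hx => ?_
      by_contra hx'
      have h1 := dotProduct_mulVec_le_H hn hσ (by norm_num : 1 ≤ 6) hx' u
      have h2 : √(8 * (6 : ℕ) / 3) / (4 + √2) ≤ 1 := by
        rw [div_le_one (by positivity), show (8 * (6 : ℕ) / 3 : ℝ) = 4 ^ 2 by norm_num,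
          Real.sqrt_sq (by norm_num)]
        linarith [Real.sqrt_nonneg 2]
      have hH : 0 ≤ H n σ u := mul_nonneg (by positivity) (Finset.sum_nonneg fun j _ =>
        mul_nonneg (absSorted_nonneg u j) (mul_nonneg hσ.le (Real.sqrt_nonneg _)))
      have h3 := mul_le_of_le_one_left hH h2
      have h4 : H n σ u < (1 / (n : ℝ)) * (x.ofLp ⬝ᵥ (X *ᵥ u)) := (le_max_left _ _).trans_lt hx
      linarith
    refine (measureReal_mono hsub).trans ((measure_largeCorrelations_le hn hp hX 6).trans ?_)
    norm_num
    linarith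

end Gaussian

end StochasticError

/-! ### Transfer to the random vector ξ. -/

theorem mainTheorem3 {n p : ℕ} (hn : 1 ≤ n) (hp : 1 ≤ p) (σ : ℝ) (hσ : 0 < σ)
    (δ₀ : ℝ) (hδ₀ : 0 < δ₀) (hδ₁ : δ₀ < 1)
    (X : Matrix (Fin n) (Fin p) ℝ)
    (hX : ∀ j : Fin p, StochasticError.empNorm (X *ᵥ Pi.single j (1 : ℝ)) ≤ 1)
    {Ω : Type*} [MeasurableSpace Ω] (P : Measure Ω) [IsProbabilityMeasure P]
    (ξ : Ω → EuclideanSpace ℝ (Fin n))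
    (hξ : HasLaw ξ (multivariateGaussian 0 (σ ^ 2 • (1 : Matrix (Fin n) (Fin n) ℝ))) P) :
    NullMeasurableSet
      {ω | ∀ u : Fin p → ℝ, (1 / (n : ℝ)) * ((ξ ω).ofLp ⬝ᵥ (X *ᵥ u)) ≤
        max (StochasticError.H n σ u) (StochasticError.G X σ δ₀ u)} P ∧
    1 - δ₀ / 2 ≤ P.real
      {ω | ∀ u : Fin p → ℝ, (1 / (n : ℝ)) * ((ξ ω).ofLp ⬝ᵥ (X *ᵥ u)) ≤
        max (StochasticError.H n σ u) (StochasticError.G X σ δ₀ u)} := by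
  have hset : {ω | ∀ u : Fin p → ℝ, (1 / (n : ℝ)) * ((ξ ω).ofLp ⬝ᵥ (X *ᵥ u)) ≤
        max (StochasticError.H n σ u) (StochasticError.G X σ δ₀ u)}
      = ξ ⁻¹' (⋃ u, StochasticError.violation X σ δ₀ u)ᶜ := by
    ext ω
    simp only [Set.mem_ofPred_eq, Set.mem_preimage, Set.mem_compl_iff, Set.mem_iUnion,
      StochasticError.violation, not_exists, not_lt]
  have hopen : IsOpen (⋃ u, StochasticError.violation X σ δ₀ u) :=
    isOpen_iUnion fun u => StochasticError.isOpen_violation δ₀ u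
  have hmeas := hopen.measurableSet.compl
  rw [hset]
  -- Only null measurability is available, since ξ is merely a.e. measurable.
  refine ⟨hξ.aemeasurable.nullMeasurable hmeas, ?_⟩
  rw [← map_measureReal_apply_of_aemeasurable hξ.aemeasurable hmeas, hξ.map_eq,
    probReal_compl_eq_one_sub hopen.measurableSet]
  linarith [StochasticError.measure_iUnion_violation_le hn hp hσ hX hδ₀]
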